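/- Let $m,n\ge 1$ be integers and $\epsilon>0$. Let $u:\mathbb R^m\to\mathbb R^n$ be a smooth map between Euclidean spaces which is a critical point of the 2-Ginzburg-Landau energy $\int \frac{|du|^2}{2}+\frac{1}{4\epsilon^n}(1-|u|^2)^2\,dx$, that is, a solution of $$\Delta u+\frac{1}{\epsilon^{n}}(1-|u|^2)\,u=0\quad\text{on }\mathbb R^m .$$ Suppose that $u(x)\to P_0$ as $|x|\to\infty$ for some point $P_0$ of the unit sphere $S^{n-1}\subset\mathbb R^n$. Then $u$ is constant and its value lies in $S^{n-1}$. -/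

import Mathlib

open scoped ContDiff Topology

/-- A smooth map `u : ℝᵐ → ℝⁿ` between Euclidean spaces is a critical point of the
2-Ginzburg-Landau energy `∫ |du|² / 2 + (1 - |u|²)² / (4 εⁿ)` if it solves the Euler-Lagrange
equation `Δ u + ε⁻ⁿ (1 - |u|²) u = 0` on the whole of `ℝᵐ`. -/
structure IsGinzburgLandauCritical {m n : ℕ} (ε : ℝ)
    (u : EuclideanSpace ℝ (Fin m) → EuclideanSpace ℝ (Fin n)) : Prop where
  smooth : ContDiff ℝ ∞ u
  eulerLagrange : ∀ x, Laplacian.laplacian u x + ((1 / ε ^ n) * (1 - ‖u x‖ ^ 2)) • u x = 0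

open MeasureTheory Filter

section Calculus

variable {m : ℕ} {G : Type*} [NormedAddCommGroup G] [NormedSpace ℝ G]
  {H : Type*} [NormedAddCommGroup H] [InnerProductSpace ℝ H]

/-- The `i`-th partial derivative of a map on `ℝᵐ`. -/
noncomputable def pd (i : Fin m) (f : EuclideanSpace ℝ (Fin m) → G)
    (x : EuclideanSpace ℝ (Fin m)) : G :=
  fderiv ℝ f x (EuclideanSpace.single i 1)

theorem ContDiff.pd {f : EuclideanSpace ℝ (Fin m) → G} (hf : ContDiff ℝ ∞ f) (i : Fin m) :
    ContDiff ℝ ∞ (pd i f) := by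
  unfold _root_.pd
  exact (hf.fderiv_right (m := ∞) (by simp)).clm_apply contDiff_const

theorem ContDiff.differentiableAt_of_smooth {f : EuclideanSpace ℝ (Fin m) → G}
    (hf : ContDiff ℝ ∞ f) (x : EuclideanSpace ℝ (Fin m)) : DifferentiableAt ℝ f x :=
  (hf.differentiable (by simp)) x

theorem pd_comm {f : EuclideanSpace ℝ (Fin m) → G} (hf : ContDiff ℝ ∞ f) (i j : Fin m)
    (x : EuclideanSpace ℝ (Fin m)) : pd i (pd j f) x = pd j (pd i f) x := by
  have h : ∀ v w : EuclideanSpace ℝ (Fin m),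
      fderiv ℝ (fun y => fderiv ℝ f y v) x w = fderiv ℝ (fderiv ℝ f) x w v := by
    intro v w
    have hd : DifferentiableAt ℝ (fderiv ℝ f) x :=
      (hf.fderiv_right (m := ∞) (by simp)).differentiable (by simp) x
    rw [fderiv_clm_apply hd (differentiableAt_const v)]
    simp
  have hs : IsSymmSndFDerivAt ℝ f x :=
    ((contDiff_infty.1 hf 2).contDiffAt (x := x)).isSymmSndFDerivAt (by simp)
  change fderiv ℝ (fun y => fderiv ℝ f y _) x _ = fderiv ℝ (fun y => fderiv ℝ f y _) x _
  rw [h, h]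
  exact hs _ _

theorem laplacian_eq_sum_pd {f : EuclideanSpace ℝ (Fin m) → G} (hf : ContDiff ℝ ∞ f)
    (x : EuclideanSpace ℝ (Fin m)) :
    Laplacian.laplacian f x = ∑ i, pd i (pd i f) x := by
  rw [InnerProductSpace.laplacian_eq_iteratedFDeriv_orthonormalBasis f
    (EuclideanSpace.basisFun (Fin m) ℝ)]
  refine Finset.sum_congr rfl fun i _ => ?_
  rw [iteratedFDeriv_two_apply]
  have hd : DifferentiableAt ℝ (fderiv ℝ f) x :=
    (hf.fderiv_right (m := ∞) (by simp)).differentiable (by simp) x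
  change _ = fderiv ℝ (fun y => fderiv ℝ f y _) x _
  rw [fderiv_clm_apply hd (differentiableAt_const _)]
  simp

theorem pd_const (i : Fin m) (a : G) : pd i (fun _ : EuclideanSpace ℝ (Fin m) => a) = 0 := by
  ext x; simp [pd]

theorem pd_add {f g : EuclideanSpace ℝ (Fin m) → G} (hf : ContDiff ℝ ∞ f) (hg : ContDiff ℝ ∞ g)
    (i : Fin m) : pd i (fun x => f x + g x) = fun x => pd i f x + pd i g x := by
  ext x
  simp only [pd]
  rw [fderiv_fun_add (hf.differentiableAt_of_smooth x) (hg.differentiableAt_of_smooth x)]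
  rfl

theorem pd_sub {f g : EuclideanSpace ℝ (Fin m) → G} (hf : ContDiff ℝ ∞ f) (hg : ContDiff ℝ ∞ g)
    (i : Fin m) : pd i (fun x => f x - g x) = fun x => pd i f x - pd i g x := by
  ext x
  simp only [pd]
  rw [fderiv_fun_sub (hf.differentiableAt_of_smooth x) (hg.differentiableAt_of_smooth x)]
  rfl

theorem pd_sum {ι : Type*} (s : Finset ι) {f : ι → EuclideanSpace ℝ (Fin m) → G}
    (hf : ∀ k, ContDiff ℝ ∞ (f k)) (i : Fin m) :
    pd i (fun x => ∑ k ∈ s, f k x) = fun x => ∑ k ∈ s, pd i (f k) x := by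
  ext x
  simp only [pd]
  rw [fderiv_fun_sum fun k _ => (hf k).differentiableAt_of_smooth x]
  simp

theorem pd_mul {f g : EuclideanSpace ℝ (Fin m) → ℝ} (hf : ContDiff ℝ ∞ f)
    (hg : ContDiff ℝ ∞ g) (i : Fin m) :
    pd i (fun x => f x * g x) = fun x => pd i f x * g x + f x * pd i g x := by
  ext x
  simp only [pd]
  rw [fderiv_fun_mul (hf.differentiableAt_of_smooth x) (hg.differentiableAt_of_smooth x)]
  simp
  ring

theorem pd_const_mul {f : EuclideanSpace ℝ (Fin m) → ℝ} (hf : ContDiff ℝ ∞ f) (a : ℝ)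
    (i : Fin m) : pd i (fun x => a * f x) = fun x => a * pd i f x := by
  rw [pd_mul contDiff_const hf, pd_const]
  simp

theorem pd_smul {f : EuclideanSpace ℝ (Fin m) → ℝ} {g : EuclideanSpace ℝ (Fin m) → G}
    (hf : ContDiff ℝ ∞ f) (hg : ContDiff ℝ ∞ g) (i : Fin m) :
    pd i (fun x => f x • g x) = fun x => pd i f x • g x + f x • pd i g x := by
  ext x
  simp only [pd]
  rw [fderiv_fun_smul (hf.differentiableAt_of_smooth x) (hg.differentiableAt_of_smooth x)]
  simp [add_comm]

theorem pd_inner {f g : EuclideanSpace ℝ (Fin m) → H} (hf : ContDiff ℝ ∞ f)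
    (hg : ContDiff ℝ ∞ g) (i : Fin m) :
    pd i (fun x => inner ℝ (f x) (g x)) =
      fun x => inner ℝ (pd i f x) (g x) + inner ℝ (f x) (pd i g x) := by
  ext x
  simp only [pd]
  rw [fderiv_inner_apply ℝ (hf.differentiableAt_of_smooth x) (hg.differentiableAt_of_smooth x)]
  ring

theorem pd_comp {b : ℝ → ℝ} (hb : ContDiff ℝ ∞ b) {f : EuclideanSpace ℝ (Fin m) → ℝ}
    (hf : ContDiff ℝ ∞ f) (i : Fin m) :
    pd i (fun x => b (f x)) = fun x => deriv b (f x) * pd i f x := by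
  ext x
  simp only [pd]
  have h := ((hb.differentiable (by simp) (f x)).hasDerivAt).comp_hasFDerivAt x
    (hf.differentiableAt_of_smooth x).hasFDerivAt
  rw [show (fun x => b (f x)) = b ∘ f from rfl, h.fderiv]
  simp

theorem pd_comp_smul (f : EuclideanSpace ℝ (Fin m) → G) (a : ℝ)
    (i : Fin m) : pd i (fun x => f (a • x)) = fun x => a • pd i f (a • x) := by
  ext x
  simp only [pd]
  rw [fderiv_comp_smul a]
  rfl

theorem contDiff_coord (j : Fin m) :
    ContDiff ℝ ∞ (fun x : EuclideanSpace ℝ (Fin m) => x j) :=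
  (EuclideanSpace.proj (𝕜 := ℝ) j : EuclideanSpace ℝ (Fin m) →L[ℝ] ℝ).contDiff

theorem pd_coord (i j : Fin m) :
    pd i (fun x : EuclideanSpace ℝ (Fin m) => x j) = fun _ => if i = j then 1 else 0 := by
  ext x
  simp only [pd]
  have h : fderiv ℝ (fun x : EuclideanSpace ℝ (Fin m) => x j) x =
      (EuclideanSpace.proj (𝕜 := ℝ) j : EuclideanSpace ℝ (Fin m) →L[ℝ] ℝ) :=
    (EuclideanSpace.proj (𝕜 := ℝ) j : EuclideanSpace ℝ (Fin m) →L[ℝ] ℝ).fderiv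
  rw [h]
  simp [eq_comm]

theorem HasCompactSupport.pd {f : EuclideanSpace ℝ (Fin m) → G} (hf : HasCompactSupport f)
    (i : Fin m) : HasCompactSupport (pd i f) :=
  HasCompactSupport.comp_left (g := fun l : EuclideanSpace ℝ (Fin m) →L[ℝ] G =>
    l (EuclideanSpace.single i 1)) (hf.fderiv (𝕜 := ℝ)) (by simp)

theorem integral_pd_eq_zero {f : EuclideanSpace ℝ (Fin m) → ℝ} (hf : ContDiff ℝ ∞ f)
    (hc : HasCompactSupport f) (i : Fin m) : ∫ x, pd i f x = 0 := by
  have hi : Integrable (pd i f) :=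
    (hf.pd i).continuous.integrable_of_hasCompactSupport (hc.pd i)
  have hi' : Integrable f := hf.continuous.integrable_of_hasCompactSupport hc
  have h := integral_mul_fderiv_eq_neg_fderiv_mul_of_integrable (μ := volume)
    (f := fun _ : EuclideanSpace ℝ (Fin m) => (1 : ℝ)) (g := f)
    (v := EuclideanSpace.single i 1) (by simp) (by simpa [pd] using! hi) (by simpa using hi')
    (fun x _ => differentiableAt_const _) (fun x _ => hf.differentiableAt_of_smooth x)
  simpa [pd] using h

theorem eq_of_pd_eq_zero {f : EuclideanSpace ℝ (Fin m) → G} (hf : ContDiff ℝ ∞ f)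
    (h : ∀ i x, pd i f x = 0) (x y : EuclideanSpace ℝ (Fin m)) : f x = f y := by
  refine is_const_of_fderiv_eq_zero (𝕜 := ℝ) (hf.differentiable (by simp)) (fun x => ?_) x y
  have : (fderiv ℝ f x : EuclideanSpace ℝ (Fin m) →ₗ[ℝ] G) = 0 := by
    refine (EuclideanSpace.basisFun (Fin m) ℝ).toBasis.ext fun i => ?_
    simpa [pd] using h i x
  ext v
  exact LinearMap.congr_fun this v

theorem hasDerivAt_line {f : EuclideanSpace ℝ (Fin m) → G} (hf : ContDiff ℝ ∞ f)
    (x : EuclideanSpace ℝ (Fin m)) (i : Fin m) (t : ℝ) :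
    HasDerivAt (fun s : ℝ => f (x + s • EuclideanSpace.single i (1 : ℝ)))
      (pd i f (x + t • EuclideanSpace.single i (1 : ℝ))) t := by
  have h1 : HasDerivAt (fun s : ℝ => x + s • EuclideanSpace.single i (1 : ℝ))
      (EuclideanSpace.single i (1 : ℝ)) t := by
    simpa using ((hasDerivAt_id t).smul_const (EuclideanSpace.single i (1 : ℝ))).const_add x
  exact (hf.differentiableAt_of_smooth _).hasFDerivAt.comp_hasDerivAt t h1

theorem IsLocalMax.pd_eq_zero {f : EuclideanSpace ℝ (Fin m) → ℝ}
    {x : EuclideanSpace ℝ (Fin m)} (hx : IsLocalMax f x) (i : Fin m) : pd i f x = 0 := by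
  simp [pd, hx.fderiv_eq_zero]

theorem IsLocalMax.pd_pd_nonpos {f : EuclideanSpace ℝ (Fin m) → ℝ} (hf : ContDiff ℝ ∞ f)
    {x : EuclideanSpace ℝ (Fin m)} (hx : IsLocalMax f x) (i : Fin m) : pd i (pd i f) x ≤ 0 := by
  by_contra! hpos
  set g : ℝ → ℝ := fun s => f (x + s • EuclideanSpace.single i (1 : ℝ)) with hg
  have hc : Continuous fun s : ℝ => x + s • EuclideanSpace.single i (1 : ℝ) := by fun_prop
  have hx' : IsLocalMax f (x + (0 : ℝ) • EuclideanSpace.single i (1 : ℝ)) := by simpa using hx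
  have hmax : IsLocalMax g 0 :=
    IsLocalMax.comp_continuous (g := fun s : ℝ => x + s • EuclideanSpace.single i (1 : ℝ))
      hx' hc.continuousAt
  have hd : deriv g = fun s => pd i f (x + s • EuclideanSpace.single i (1 : ℝ)) :=
    funext fun t => (hasDerivAt_line hf x i t).deriv
  have hdd : deriv (deriv g) = fun s => pd i (pd i f) (x + s • EuclideanSpace.single i (1 : ℝ)) := by
    rw [hd]
    exact funext fun t => (hasDerivAt_line (hf.pd i) x i t).deriv
  have hmin : IsLocalMin g 0 :=
    isLocalMin_of_deriv_deriv_pos (by rw [hdd]; simpa using hpos) hmax.deriv_eq_zero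
      (hasDerivAt_line hf x i 0).continuousAt
  have hconst : g =ᶠ[𝓝 0] fun _ => g 0 := by
    filter_upwards [hmax, hmin] with s h1 h2 using le_antisymm h1 h2
  have h0 : deriv (deriv g) 0 = 0 := by
    rw [hconst.deriv.deriv_eq]
    simp
  rw [hdd] at h0
  simp at h0
  linarith

end Calculus

section FiniteEnergy

theorem Monotone.zero_le_deriv {b : ℝ → ℝ} (hb : Monotone b) (x : ℝ) : 0 ≤ deriv b x := by
  by_cases hd : DifferentiableAt ℝ b x
  · refine _root_.ge_of_tendsto (hasDerivAt_iff_tendsto_slope.1 hd.hasDerivAt)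
      (Eventually.of_forall fun y => ?_)
    rw [slope_def_field]
    rcases le_total x y with h | h
    · exact div_nonneg (sub_nonneg.2 (hb h)) (sub_nonneg.2 h)
    · exact div_nonneg_of_nonpos (sub_nonpos.2 (hb h)) (sub_nonpos.2 h)
  · rw [deriv_zero_of_not_differentiableAt hd]

/-- Fatou's lemma for nonnegative functions with bounded integrals. -/
theorem integrable_of_tendsto_of_integral_le {α : Type*} [MeasurableSpace α] {μ : Measure α}
    {g : ℕ → α → ℝ} {f : α → ℝ} {C : ℝ} (hg : ∀ k, Integrable (g k) μ)
    (hg0 : ∀ k x, 0 ≤ g k x) (hlim : ∀ x, Tendsto (fun k => g k x) atTop (𝓝 (f x)))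
    (hC : ∀ k, ∫ x, g k x ∂μ ≤ C) : Integrable f μ := by
  refine ⟨aestronglyMeasurable_of_tendsto_ae atTop (fun k => (hg k).aestronglyMeasurable)
    (Eventually.of_forall hlim), ?_⟩
  have hk : ∀ k, ∫⁻ x, ‖g k x‖ₑ ∂μ ≤ ENNReal.ofReal C := by
    intro k
    have : ∀ x, ‖g k x‖ₑ = ENNReal.ofReal (g k x) := fun x => Real.enorm_of_nonneg (hg0 k x)
    simp_rw [this]
    rw [← ofReal_integral_eq_lintegral_ofReal (hg k) (Eventually.of_forall (hg0 k))]
    exact ENNReal.ofReal_le_ofReal (hC k)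
  calc ∫⁻ x, ‖f x‖ₑ ∂μ = ∫⁻ x, liminf (fun k => ‖g k x‖ₑ) atTop ∂μ :=
        lintegral_congr fun x => (hlim x).enorm.liminf_eq.symm
    _ ≤ liminf (fun k => ∫⁻ x, ‖g k x‖ₑ ∂μ) atTop :=
        lintegral_liminf_le' fun k => (hg k).aestronglyMeasurable.aemeasurable.enorm
    _ ≤ ENNReal.ofReal C := liminf_le_of_frequently_le' (Frequently.of_forall hk)
    _ < ⊤ := ENNReal.ofReal_lt_top

variable {m : ℕ}

theorem hasCompactSupport_of_eventually_cobounded {G : Type*} [Zero G]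
    {f : EuclideanSpace ℝ (Fin m) → G}
    (h : ∀ᶠ x in Bornology.cobounded (EuclideanSpace ℝ (Fin m)), f x = 0) :
    HasCompactSupport f := by
  rw [hasCompactSupport_iff_eventuallyEq, coclosedCompact_eq_cocompact,
    ← Metric.cobounded_eq_cocompact]
  exact h

/-- Let `F ≥ 0` tend to zero at infinity and `Δ F ≥ h` outside of a compact set, where `h ≥ 0`
vanishes at the zeros of `F`. Then `h` is integrable. -/
theorem integrable_of_le_laplacian {F h : EuclideanSpace ℝ (Fin m) → ℝ} (hF : ContDiff ℝ ∞ F)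
    (hF0 : ∀ x, 0 ≤ F x)
    (hlim : Tendsto F (Bornology.cobounded (EuclideanSpace ℝ (Fin m))) (𝓝 0))
    (hh : Continuous h) (h0 : ∀ x, 0 ≤ h x) (hz : ∀ x, F x = 0 → h x = 0)
    (hev : ∀ᶠ x in Bornology.cobounded (EuclideanSpace ℝ (Fin m)), h x ≤ ∑ i, pd i (pd i F) x) :
    Integrable h := by
  obtain ⟨R, hR0, hR⟩ : ∃ R : ℝ, 0 < R ∧ ∀ x : EuclideanSpace ℝ (Fin m), R < ‖x‖ →
      h x ≤ ∑ i, pd i (pd i F) x := by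
    rw [← comap_norm_atTop] at hev
    obtain ⟨R, hR⟩ := eventually_atTop.1 (eventually_comap.1 hev)
    exact ⟨max R 1, by positivity, fun x hx => hR _ ((le_max_left _ _).trans hx.le) x rfl⟩
  let η : ContDiffBump (0 : EuclideanSpace ℝ (Fin m)) := ⟨R, R + 1, hR0, by linarith⟩
  have hη : ContDiff ℝ ∞ (η : EuclideanSpace ℝ (Fin m) → ℝ) := η.contDiff
  set ζ : EuclideanSpace ℝ (Fin m) → ℝ := fun x => 1 - η x with hζdef
  have hζ : ContDiff ℝ ∞ ζ := contDiff_const.sub hη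
  have hζ0 : ∀ x, 0 ≤ ζ x := fun x => sub_nonneg.2 η.le_one
  have hζin : ∀ x, ‖x‖ ≤ R → ζ x = 0 := by
    intro x hx
    have : η x = 1 := η.one_of_mem_closedBall (by simpa using hx)
    simp [hζdef, this]
  have hpdζ : ∀ i, HasCompactSupport (pd i ζ) := by
    intro i
    have : pd i ζ = fun x => -pd i η x := by
      rw [hζdef, pd_sub contDiff_const hη, pd_const]; simp
    rw [this]
    exact (η.hasCompactSupport.pd i).neg
  let b : ℕ → ℝ → ℝ := fun k s => Real.smoothTransition (k * s - 1)
  have hb : ∀ k, ContDiff ℝ ∞ (b k) := fun k =>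
    Real.smoothTransition.contDiff.comp ((contDiff_const.mul contDiff_id).sub contDiff_const)
  have hbmono : ∀ k, Monotone (b k) := fun k s t hst =>
    Real.smoothTransition.monotone (by gcongr)
  have hb0 : ∀ k s, 0 ≤ b k s := fun k s => Real.smoothTransition.nonneg _
  have hb1 : ∀ k s, b k s ≤ 1 := fun k s => Real.smoothTransition.le_one _
  have hbF : ∀ k, ContDiff ℝ ∞ fun x => b k (F x) := fun k => (hb k).comp hF
  have hbc : ∀ k, HasCompactSupport fun x => b k (F x) := by
    intro k
    apply hasCompactSupport_of_eventually_cobounded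
    have hlt : ∀ᶠ x in Bornology.cobounded (EuclideanSpace ℝ (Fin m)), k * F x < 1 :=
      (by simpa using hlim.const_mul (k : ℝ) :
        Tendsto (fun x => k * F x) _ (𝓝 0)).eventually_lt_const one_pos
    filter_upwards [hlt] with x hx
    exact Real.smoothTransition.zero_of_nonpos (by linarith)
  let φ : ℕ → EuclideanSpace ℝ (Fin m) → ℝ := fun k x => ζ x * b k (F x)
  have hφ : ∀ k, ContDiff ℝ ∞ (φ k) := fun k => hζ.mul (hbF k)
  have hφc : ∀ k, HasCompactSupport (φ k) := fun k => (hbc k).mul_left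
  have hφ0 : ∀ k x, 0 ≤ φ k x := fun k x => mul_nonneg (hζ0 x) (hb0 k _)
  let B : EuclideanSpace ℝ (Fin m) → ℝ := fun x => ∑ i, |pd i ζ x * pd i F x|
  have hBi : Integrable B := by
    refine integrable_finsetSum _ fun i _ => Integrable.abs ?_
    exact ((hζ.pd i).continuous.mul (hF.pd i).continuous).integrable_of_hasCompactSupport
      (hpdζ i).mul_right
  have hgi : ∀ k, Integrable fun x => φ k x * h x := fun k =>
    ((hφ k).continuous.mul hh).integrable_of_hasCompactSupport (hφc k).mul_right
  have key : ∀ k, ∫ x, φ k x * h x ≤ ∫ x, B x := by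
    intro k
    have hV : ∀ i, ContDiff ℝ ∞ fun x => φ k x * pd i F x := fun i => (hφ k).mul (hF.pd i)
    have hVc : ∀ i, HasCompactSupport fun x => φ k x * pd i F x := fun i => (hφc k).mul_right
    have hVi : ∀ i, Integrable (pd i fun x => φ k x * pd i F x) := fun i =>
      ((hV i).pd i).continuous.integrable_of_hasCompactSupport ((hVc i).pd i)
    have hzero : ∫ x, ∑ i, pd i (fun x => φ k x * pd i F x) x = 0 := by
      rw [integral_finsetSum _ fun i _ => hVi i]
      exact Finset.sum_eq_zero fun i _ => integral_pd_eq_zero (hV i) (hVc i) i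
    have hpt : ∀ x, φ k x * h x - B x ≤ ∑ i, pd i (fun x => φ k x * pd i F x) x := by
      intro x
      have hpd : ∀ i, pd i (fun x => φ k x * pd i F x) x =
          b k (F x) * (pd i ζ x * pd i F x) + ζ x * deriv (b k) (F x) * pd i F x ^ 2
            + φ k x * pd i (pd i F) x := by
        intro i
        rw [pd_mul (hφ k) (hF.pd i), pd_mul hζ (hbF k), pd_comp (hb k) hF]
        ring
      have h1 : ∀ i, -|pd i ζ x * pd i F x| + φ k x * pd i (pd i F) x ≤
          pd i (fun x => φ k x * pd i F x) x := by
        intro i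
        rw [hpd i]
        have h2 : 0 ≤ ζ x * deriv (b k) (F x) * pd i F x ^ 2 :=
          mul_nonneg (mul_nonneg (hζ0 x) ((hbmono k).zero_le_deriv _)) (sq_nonneg _)
        have h3 : |b k (F x) * (pd i ζ x * pd i F x)| ≤ |pd i ζ x * pd i F x| := by
          rw [abs_mul, abs_of_nonneg (hb0 k _)]
          exact mul_le_of_le_one_left (abs_nonneg _) (hb1 k _)
        linarith [neg_abs_le (b k (F x) * (pd i ζ x * pd i F x))]
      have h4 : φ k x * h x ≤ φ k x * ∑ i, pd i (pd i F) x := by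
        rcases le_or_gt ‖x‖ R with hx | hx
        · simp [φ, hζin x hx]
        · exact mul_le_mul_of_nonneg_left (hR x hx) (hφ0 k x)
      have h5 := Finset.sum_le_sum fun i (_ : i ∈ Finset.univ) => h1 i
      rw [Finset.sum_add_distrib, ← Finset.mul_sum, Finset.sum_neg_distrib] at h5
      linarith
    have hint := integral_mono ((hgi k).sub hBi) (integrable_finsetSum _ fun i _ => hVi i) hpt
    rw [hzero] at hint
    have hsub : ∫ x, (φ k x * h x - B x) = (∫ x, φ k x * h x) - ∫ x, B x :=
      integral_sub (hgi k) hBi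
    have hint' : ∫ x, (φ k x * h x - B x) ≤ 0 := hint
    linarith
  have hζh : Integrable fun x => ζ x * h x := by
    refine integrable_of_tendsto_of_integral_le hgi
      (fun k x => mul_nonneg (hφ0 k x) (h0 x)) (fun x => ?_) key
    rcases (hF0 x).eq_or_lt with hx | hx
    · simp [hz x hx.symm]
    · refine tendsto_const_nhds.congr' ?_
      have hlarge : ∀ᶠ k : ℕ in atTop, 2 ≤ k * F x :=
        (tendsto_natCast_atTop_atTop.atTop_mul_const hx).eventually_ge_atTop 2
      filter_upwards [hlarge] with k hk
      have : b k (F x) = 1 := Real.smoothTransition.one_of_one_le (by linarith)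
      simp [φ, this]
  have hηh : Integrable fun x => η x * h x :=
    (hη.continuous.mul hh).integrable_of_hasCompactSupport η.hasCompactSupport.mul_right
  refine (hζh.add hηh).congr (Eventually.of_forall fun x => ?_)
  simp only [hζdef, Pi.add_apply]
  ring

end FiniteEnergy

section GinzburgLandau

variable {m : ℕ} {H : Type*} [NormedAddCommGroup H] [InnerProductSpace ℝ H]

/-- The squared norm `|du|²` of the differential. -/
noncomputable def gradSq (u : EuclideanSpace ℝ (Fin m) → H) (x : EuclideanSpace ℝ (Fin m)) : ℝ :=
  ∑ i, ‖pd i u x‖ ^ 2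

theorem gradSq_nonneg (u : EuclideanSpace ℝ (Fin m) → H) (x : EuclideanSpace ℝ (Fin m)) :
    0 ≤ gradSq u x := Finset.sum_nonneg fun _ _ => sq_nonneg _

theorem pd_eq_zero_of_gradSq {u : EuclideanSpace ℝ (Fin m) → H} {x : EuclideanSpace ℝ (Fin m)}
    (h : gradSq u x = 0) (i : Fin m) : pd i u x = 0 := by
  simpa using (Finset.sum_eq_zero_iff_of_nonneg fun _ _ => sq_nonneg _).1 h i (Finset.mem_univ i)

theorem ContDiff.gradSq {u : EuclideanSpace ℝ (Fin m) → H} (hu : ContDiff ℝ ∞ u) :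
    ContDiff ℝ ∞ (gradSq u) :=
  ContDiff.sum fun i _ => (hu.pd i).norm_sq ℝ

theorem pd_norm_sq {u : EuclideanSpace ℝ (Fin m) → H} (hu : ContDiff ℝ ∞ u) (i : Fin m) :
    pd i (fun x => ‖u x‖ ^ 2) = fun x => 2 * inner ℝ (u x) (pd i u x) := by
  have : (fun x => ‖u x‖ ^ 2) = fun x => inner ℝ (u x) (u x) :=
    funext fun x => (real_inner_self_eq_norm_sq _).symm
  rw [this, pd_inner hu hu]
  ext x
  rw [real_inner_comm]
  ring

theorem pd_pd_norm_sq {u : EuclideanSpace ℝ (Fin m) → H} (hu : ContDiff ℝ ∞ u) (i : Fin m)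
    (x : EuclideanSpace ℝ (Fin m)) :
    pd i (pd i fun x => ‖u x‖ ^ 2) x =
      2 * ‖pd i u x‖ ^ 2 + 2 * inner ℝ (u x) (pd i (pd i u) x) := by
  rw [pd_norm_sq hu, pd_const_mul (hu.inner ℝ (hu.pd i)), pd_inner hu (hu.pd i),
    ← real_inner_self_eq_norm_sq]
  ring

variable {u : EuclideanSpace ℝ (Fin m) → H} {c : ℝ}

theorem sum_pd_pd_norm_sq (hu : ContDiff ℝ ∞ u)
    (heq : ∀ x, ∑ i, pd i (pd i u) x = -(c * (1 - ‖u x‖ ^ 2)) • u x)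
    (x : EuclideanSpace ℝ (Fin m)) :
    ∑ i, pd i (pd i fun x => ‖u x‖ ^ 2) x =
      2 * gradSq u x - 2 * c * (1 - ‖u x‖ ^ 2) * ‖u x‖ ^ 2 := by
  simp_rw [pd_pd_norm_sq hu, Finset.sum_add_distrib, ← Finset.mul_sum, ← inner_sum, heq x,
    inner_smul_right, real_inner_self_eq_norm_sq]
  rw [gradSq]
  ring

theorem sum_pd_pd_inner (hu : ContDiff ℝ ∞ u)
    (heq : ∀ x, ∑ i, pd i (pd i u) x = -(c * (1 - ‖u x‖ ^ 2)) • u x) (P : H)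
    (x : EuclideanSpace ℝ (Fin m)) :
    ∑ i, pd i (pd i fun x => inner ℝ P (u x)) x = -(c * (1 - ‖u x‖ ^ 2)) * inner ℝ P (u x) := by
  have h : ∀ {f : EuclideanSpace ℝ (Fin m) → H}, ContDiff ℝ ∞ f → ∀ i,
      pd i (fun x => inner ℝ P (f x)) = fun x => inner ℝ P (pd i f x) := by
    intro f hf i
    rw [pd_inner contDiff_const hf, pd_const]
    simp
  simp_rw [h hu, h (hu.pd _), ← inner_sum, heq x, inner_smul_right]

/-- The maximum principle: a solution with values of norm one at infinity has norm at most one. -/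
theorem norm_le_one_of_tendsto (hu : ContDiff ℝ ∞ u) (hc : 0 < c)
    (heq : ∀ x, ∑ i, pd i (pd i u) x = -(c * (1 - ‖u x‖ ^ 2)) • u x) {P : H} (hP : ‖P‖ = 1)
    (hlim : Tendsto u (Bornology.cobounded (EuclideanSpace ℝ (Fin m))) (𝓝 P))
    (x : EuclideanSpace ℝ (Fin m)) : ‖u x‖ ≤ 1 := by
  by_contra! hx
  have hlim' : Tendsto (fun y => ‖u y‖ ^ 2) (cocompact (EuclideanSpace ℝ (Fin m))) (𝓝 1) := by
    rw [← Metric.cobounded_eq_cocompact]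
    simpa [hP] using hlim.norm.pow 2
  have hs : ContDiff ℝ ∞ fun y => ‖u y‖ ^ 2 := hu.norm_sq ℝ
  have h1 : 1 < ‖u x‖ ^ 2 := by nlinarith
  obtain ⟨y, hy⟩ := hs.continuous.exists_forall_ge' x (hlim'.eventually_le_const h1)
  have hmax : IsLocalMax (fun y => ‖u y‖ ^ 2) y := Eventually.of_forall hy
  have hle := Finset.sum_nonpos fun i (_ : i ∈ Finset.univ) => hmax.pd_pd_nonpos hs i
  rw [sum_pd_pd_norm_sq hu heq y] at hle
  have h2 : 1 < ‖u y‖ ^ 2 := h1.trans_le (hy x)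
  have h3 : 0 < c * (‖u y‖ ^ 2 - 1) * ‖u y‖ ^ 2 :=
    mul_pos (mul_pos hc (by linarith)) (by linarith)
  linarith [gradSq_nonneg u y]

theorem gradSq_eq_zero_of_norm_eq_one (hu : ContDiff ℝ ∞ u)
    (heq : ∀ x, ∑ i, pd i (pd i u) x = -(c * (1 - ‖u x‖ ^ 2)) • u x) (hle : ∀ x, ‖u x‖ ≤ 1)
    {x : EuclideanSpace ℝ (Fin m)} (hx : ‖u x‖ = 1) : gradSq u x = 0 := by
  have hs : ContDiff ℝ ∞ fun y => ‖u y‖ ^ 2 := hu.norm_sq ℝ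
  have hmax : IsLocalMax (fun y => ‖u y‖ ^ 2) x := by
    refine Eventually.of_forall fun y => ?_
    simp only [hx]
    exact pow_le_pow_left₀ (norm_nonneg _) (hle y) 2
  have h := Finset.sum_nonpos fun i (_ : i ∈ Finset.univ) => hmax.pd_pd_nonpos hs i
  rw [sum_pd_pd_norm_sq hu heq x, hx] at h
  linarith [gradSq_nonneg u x]

/-- A solution which tends to a point of the unit sphere at infinity has finite energy. -/
theorem integrable_gradSq_add (hu : ContDiff ℝ ∞ u) (hc : 0 < c)
    (heq : ∀ x, ∑ i, pd i (pd i u) x = -(c * (1 - ‖u x‖ ^ 2)) • u x) {P : H} (hP : ‖P‖ = 1)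
    (hlim : Tendsto u (Bornology.cobounded (EuclideanSpace ℝ (Fin m))) (𝓝 P)) :
    Integrable fun x => gradSq u x / 2 + c / 4 * (1 - ‖u x‖ ^ 2) := by
  have hle := norm_le_one_of_tendsto hu hc heq hP hlim
  have hsq : ∀ x, 0 ≤ 1 - ‖u x‖ ^ 2 := fun x => by nlinarith [hle x, norm_nonneg (u x)]
  have hs : ContDiff ℝ ∞ fun y => ‖u y‖ ^ 2 := hu.norm_sq ℝ
  have hv : ContDiff ℝ ∞ fun y => inner ℝ P (u y) := contDiff_const.inner ℝ hu
  set F : EuclideanSpace ℝ (Fin m) → ℝ :=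
    fun x => ((1 / 4) * ‖u x‖ ^ 2 - inner ℝ P (u x)) + 3 / 4 with hFdef
  have hF : ContDiff ℝ ∞ F := ((contDiff_const.mul hs).sub hv).add contDiff_const
  have hFeq : ∀ x, F x = ‖u x - P‖ ^ 2 / 2 + (1 - ‖u x‖ ^ 2) / 4 := by
    intro x
    rw [norm_sub_sq_real, hP, real_inner_comm]
    simp only [hFdef]
    ring
  have hlap : ∀ x, ∑ i, pd i (pd i F) x =
      gradSq u x / 2 + c * (1 - ‖u x‖ ^ 2) * (inner ℝ P (u x) - ‖u x‖ ^ 2 / 2) := by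
    intro x
    have h1 : ∀ i, pd i F = fun x => (1 / 4) * pd i (fun x => ‖u x‖ ^ 2) x
        - pd i (fun x => inner ℝ P (u x)) x := by
      intro i
      rw [hFdef, pd_add ((contDiff_const.mul hs).sub hv) contDiff_const, pd_const,
        pd_sub (contDiff_const.mul hs) hv, pd_const_mul hs]
      simp
    have h2 : ∀ i, pd i (pd i F) x = (1 / 4) * pd i (pd i fun x => ‖u x‖ ^ 2) x
        - pd i (pd i fun x => inner ℝ P (u x)) x := by
      intro i
      rw [h1, pd_sub (contDiff_const.mul (hs.pd i)) (hv.pd i), pd_const_mul (hs.pd i)]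
    simp_rw [h2, Finset.sum_sub_distrib, ← Finset.mul_sum, sum_pd_pd_norm_sq hu heq,
      sum_pd_pd_inner hu heq]
    ring
  have hlimF : Tendsto F (Bornology.cobounded (EuclideanSpace ℝ (Fin m))) (𝓝 0) := by
    simp_rw [funext hFeq]
    have := (((hlim.sub_const P).norm.pow 2).div_const 2).add
      (((hlim.norm.pow 2).const_sub 1).div_const 4)
    simpa [hP] using this
  have hlim1 : Tendsto (fun x => inner ℝ P (u x) - ‖u x‖ ^ 2 / 2)
      (Bornology.cobounded (EuclideanSpace ℝ (Fin m))) (𝓝 (1 - 1 / 2)) := by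
    have := ((tendsto_const_nhds (x := P)).inner (𝕜 := ℝ) hlim).sub
      ((hlim.norm.pow 2).div_const 2)
    simpa [hP, real_inner_self_eq_norm_sq] using this
  refine integrable_of_le_laplacian hF (fun x => ?_) hlimF ?_ (fun x => ?_) (fun x hx => ?_) ?_
  · rw [hFeq]
    linarith [hsq x, sq_nonneg ‖u x - P‖]
  · exact (hu.gradSq.continuous.div_const 2).add
      (continuous_const.mul (continuous_const.sub hs.continuous))
  · have := mul_nonneg hc.le (hsq x)
    linarith [gradSq_nonneg u x]
  · rw [hFeq] at hx
    have h1 : 1 - ‖u x‖ ^ 2 = 0 := by linarith [hsq x, sq_nonneg ‖u x - P‖]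
    have h2 : ‖u x‖ = 1 := by nlinarith [norm_nonneg (u x)]
    rw [gradSq_eq_zero_of_norm_eq_one hu heq hle h2, h1]
    simp
  · filter_upwards [hlim1.eventually_const_le (show (1 / 4 : ℝ) < 1 - 1 / 2 by norm_num)]
      with x hx
    rw [hlap]
    have := mul_le_mul_of_nonneg_left hx (mul_nonneg hc.le (hsq x))
    linarith

end GinzburgLandau

section Pohozaev

variable {m : ℕ} {H : Type*} [NormedAddCommGroup H] [InnerProductSpace ℝ H]

/-- The energy density `|du|² / 2 + c (1 - |u|²)² / 4`. -/
noncomputable def energyDensity (c : ℝ) (u : EuclideanSpace ℝ (Fin m) → H)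
    (x : EuclideanSpace ℝ (Fin m)) : ℝ :=
  (1 / 2) * gradSq u x + (c / 4) * ((1 - ‖u x‖ ^ 2) * (1 - ‖u x‖ ^ 2))

variable {u : EuclideanSpace ℝ (Fin m) → H} {c : ℝ}

theorem ContDiff.energyDensity (hu : ContDiff ℝ ∞ u) (c : ℝ) :
    ContDiff ℝ ∞ (energyDensity c u) :=
  have hr : ContDiff ℝ ∞ fun x => 1 - ‖u x‖ ^ 2 := contDiff_const.sub (hu.norm_sq ℝ)
  (contDiff_const.mul hu.gradSq).add (contDiff_const.mul (hr.mul hr))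

theorem pd_one_sub_norm_sq (hu : ContDiff ℝ ∞ u) (i : Fin m) :
    pd i (fun x => 1 - ‖u x‖ ^ 2) = fun x => -(2 * inner ℝ (u x) (pd i u x)) := by
  rw [pd_sub contDiff_const (hu.norm_sq ℝ), pd_const, pd_norm_sq hu]
  simp

theorem pd_energyDensity (hu : ContDiff ℝ ∞ u) (c : ℝ) (i : Fin m) :
    pd i (energyDensity c u) = fun x =>
      ∑ k, inner ℝ (pd k u x) (pd i (pd k u) x)
        - c * (1 - ‖u x‖ ^ 2) * inner ℝ (u x) (pd i u x) := by
  have hr : ContDiff ℝ ∞ fun x => 1 - ‖u x‖ ^ 2 := contDiff_const.sub (hu.norm_sq ℝ)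
  have hg : pd i (gradSq u) = fun x => ∑ k, 2 * inner ℝ (pd k u x) (pd i (pd k u) x) := by
    change pd i (fun x => ∑ k, ‖pd k u x‖ ^ 2) = _
    rw [pd_sum _ fun k => (hu.pd k).norm_sq ℝ]
    simp_rw [pd_norm_sq (hu.pd _)]
  change pd i (fun x => (1 / 2) * gradSq u x +
    (c / 4) * ((1 - ‖u x‖ ^ 2) * (1 - ‖u x‖ ^ 2))) = _
  rw [pd_add (contDiff_const.mul hu.gradSq) (contDiff_const.mul (hr.mul hr)),
    pd_const_mul hu.gradSq, pd_const_mul (hr.mul hr), pd_mul hr hr, pd_one_sub_norm_sq hu, hg]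
  ext x
  simp only [← Finset.mul_sum]
  ring

/-- The radial derivative `∑ xⱼ ∂ⱼu`. -/
noncomputable def radialDeriv (u : EuclideanSpace ℝ (Fin m) → H)
    (x : EuclideanSpace ℝ (Fin m)) : H := ∑ j, x j • pd j u x

theorem ContDiff.radialDeriv (hu : ContDiff ℝ ∞ u) : ContDiff ℝ ∞ (radialDeriv u) :=
  ContDiff.sum fun j _ => (contDiff_coord j).smul (hu.pd j)

theorem pd_radialDeriv (hu : ContDiff ℝ ∞ u) (i : Fin m) :
    pd i (radialDeriv u) = fun x => pd i u x + ∑ j, x j • pd i (pd j u) x := by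
  change pd i (fun x => ∑ j, x j • pd j u x) = _
  rw [pd_sum (f := fun j x => x j • pd j u x) _ fun j => (contDiff_coord j).smul (hu.pd j)]
  simp_rw [pd_smul (contDiff_coord _) (hu.pd _), pd_coord, Finset.sum_add_distrib]
  simp

/-- The stress-energy tensor of `u` applied to the radial vector field. -/
noncomputable def stressField (c : ℝ) (u : EuclideanSpace ℝ (Fin m) → H) (i : Fin m)
    (x : EuclideanSpace ℝ (Fin m)) : ℝ :=
  x i * energyDensity c u x - inner ℝ (pd i u x) (radialDeriv u x)

theorem ContDiff.stressField (hu : ContDiff ℝ ∞ u) (c : ℝ) (i : Fin m) :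
    ContDiff ℝ ∞ (stressField c u i) :=
  ((contDiff_coord i).mul (hu.energyDensity c)).sub ((hu.pd i).inner ℝ hu.radialDeriv)

theorem sum_pd_stressField (hu : ContDiff ℝ ∞ u)
    (heq : ∀ x, ∑ i, pd i (pd i u) x = -(c * (1 - ‖u x‖ ^ 2)) • u x)
    (x : EuclideanSpace ℝ (Fin m)) :
    ∑ i, pd i (stressField c u i) x = m * energyDensity c u x - gradSq u x := by
  have h : ∀ i, pd i (stressField c u i) x = energyDensity c u x
      + (∑ k, x i * inner ℝ (pd k u x) (pd i (pd k u) x)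
        - c * (1 - ‖u x‖ ^ 2) * inner ℝ (u x) (x i • pd i u x))
      - inner ℝ (pd i (pd i u) x) (radialDeriv u x) - ‖pd i u x‖ ^ 2
      - ∑ k, x k * inner ℝ (pd i u x) (pd i (pd k u) x) := by
    intro i
    change pd i (fun x => x i * energyDensity c u x
      - inner ℝ (pd i u x) (radialDeriv u x)) x = _
    rw [pd_sub ((contDiff_coord i).mul (hu.energyDensity c)) ((hu.pd i).inner ℝ hu.radialDeriv),
      pd_mul (contDiff_coord i) (hu.energyDensity c), pd_inner (hu.pd i) hu.radialDeriv,
      pd_radialDeriv hu, pd_energyDensity hu, pd_coord]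
    simp only [inner_add_right, inner_sum, inner_smul_right, real_inner_self_eq_norm_sq, if_true,
      ← Finset.mul_sum]
    ring
  simp_rw [h, Finset.sum_sub_distrib, Finset.sum_add_distrib, Finset.sum_sub_distrib,
    ← Finset.mul_sum, ← inner_sum, ← sum_inner, heq x]
  have hswap : ∑ i, ∑ k, x i * inner ℝ (pd k u x) (pd i (pd k u) x) =
      ∑ i, ∑ k, x k * inner ℝ (pd i u x) (pd i (pd k u) x) := by
    rw [Finset.sum_comm]
    exact Finset.sum_congr rfl fun i _ => Finset.sum_congr rfl fun k _ => by rw [pd_comm hu]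
  simp_rw [Finset.mul_sum] at hswap ⊢
  rw [hswap, real_inner_smul_left, gradSq, radialDeriv]
  simp
  ring

theorem tendsto_integral_comp_smul_mul {g f : EuclideanSpace ℝ (Fin m) → ℝ} (hg : Continuous g)
    (hgc : HasCompactSupport g) (hf : Integrable f) :
    (∀ k : ℕ, Integrable fun x => g (((k : ℝ) + 1)⁻¹ • x) * f x) ∧
    Tendsto (fun k : ℕ => ∫ x, g (((k : ℝ) + 1)⁻¹ • x) * f x) atTop (𝓝 (g 0 * ∫ x, f x)) := by
  obtain ⟨C, hC⟩ := hgc.exists_bound_of_continuous hg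
  have hi : ∀ k : ℕ, Integrable fun x => g (((k : ℝ) + 1)⁻¹ • x) * f x := fun k =>
    hf.bdd_mul (hg.comp (continuous_const_smul _)).aestronglyMeasurable
      (Eventually.of_forall fun x => hC _)
  refine ⟨hi, ?_⟩
  rw [← integral_const_mul]
  refine tendsto_integral_of_dominated_convergence (fun x => C * ‖f x‖)
    (fun k => (hi k).aestronglyMeasurable) (hf.norm.const_mul C)
    (fun k => Eventually.of_forall fun x => ?_) (Eventually.of_forall fun x => ?_)
  · rw [norm_mul]
    exact mul_le_mul_of_nonneg_right (hC _) (norm_nonneg _)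
  · have h1 : Tendsto (fun k : ℕ => ((k : ℝ) + 1)⁻¹) atTop (𝓝 0) := by
      simpa [one_div] using tendsto_one_div_add_atTop_nhds_zero_nat (𝕜 := ℝ)
    have h2 : Tendsto (fun k : ℕ => ((k : ℝ) + 1)⁻¹ • x) atTop (𝓝 0) := by
      simpa using h1.smul_const x
    exact ((hg.tendsto 0).comp h2).mul_const _

/-- **Pohozaev's identity** for solutions of finite energy. -/
theorem integral_pohozaev (hu : ContDiff ℝ ∞ u)
    (heq : ∀ x, ∑ i, pd i (pd i u) x = -(c * (1 - ‖u x‖ ^ 2)) • u x)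
    (hA : Integrable (gradSq u)) (he : Integrable (energyDensity c u)) :
    ∫ x, (m * energyDensity c u x - gradSq u x) = 0 := by
  let η : ContDiffBump (0 : EuclideanSpace ℝ (Fin m)) := ⟨1, 2, one_pos, one_lt_two⟩
  have hη : ContDiff ℝ ∞ (η : EuclideanSpace ℝ (Fin m) → ℝ) := η.contDiff
  have hη0 : η 0 = 1 := η.one_of_mem_closedBall (by simp [η])
  have hsq : ∀ i, Integrable fun x => ‖pd i u x‖ ^ 2 := fun i =>
    hA.mono' ((hu.pd i).norm_sq ℝ).continuous.aestronglyMeasurable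
      (Eventually.of_forall fun x => by
        rw [Real.norm_of_nonneg (sq_nonneg _)]
        exact Finset.single_le_sum (f := fun i => ‖pd i u x‖ ^ 2) (fun _ _ => sq_nonneg _)
          (Finset.mem_univ i))
  have hin : ∀ i j, Integrable fun x => inner ℝ (pd i u x) (pd j u x) := fun i j =>
    ((hsq i).add (hsq j)).mono' ((hu.pd i).inner ℝ (hu.pd j)).continuous.aestronglyMeasurable
      (Eventually.of_forall fun x => by
        have := norm_inner_le_norm (𝕜 := ℝ) (pd i u x) (pd j u x)
        simp only [Pi.add_apply]
        nlinarith [sq_nonneg (‖pd i u x‖ - ‖pd j u x‖), sq_nonneg ‖pd i u x‖,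
          sq_nonneg ‖pd j u x‖])
  have hD : Integrable fun x => m * energyDensity c u x - gradSq u x := (he.const_mul _).sub hA
  let K : Fin m → Fin m → EuclideanSpace ℝ (Fin m) → ℝ := fun i j y => pd i η y * y j
  have hK : ∀ i j, Continuous (K i j) := fun i j =>
    (hη.pd i).continuous.mul (contDiff_coord j).continuous
  have hKc : ∀ i j, HasCompactSupport (K i j) := fun i j => (η.hasCompactSupport.pd i).mul_right
  have hK0 : ∀ i j, K i j 0 = 0 := fun i j => by simp [K]
  have t1 := fun i => tendsto_integral_comp_smul_mul (hK i i) (hKc i i) he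
  have t2 := fun i j => tendsto_integral_comp_smul_mul (hK i j) (hKc i j) (hin i j)
  have t3 := tendsto_integral_comp_smul_mul hη.continuous η.hasCompactSupport hD
  have hlim := (tendsto_finsetSum Finset.univ fun i _ => (t1 i).2.sub
    (tendsto_finsetSum Finset.univ fun j _ => (t2 i j).2)).add t3.2
  simp only [hK0, hη0, zero_mul, Finset.sum_const_zero, sub_zero, zero_add, one_mul] at hlim
  refine tendsto_nhds_unique hlim (tendsto_const_nhds.congr fun k => ?_)
  set a : ℝ := ((k : ℝ) + 1)⁻¹ with ha
  have hηa : ContDiff ℝ ∞ fun x : EuclideanSpace ℝ (Fin m) => η (a • x) :=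
    hη.comp (contDiff_const_smul a)
  have hηc : HasCompactSupport fun x : EuclideanSpace ℝ (Fin m) => η (a • x) :=
    η.hasCompactSupport.comp_smul (by positivity)
  have hV : ∀ i, ContDiff ℝ ∞ fun x => η (a • x) * stressField c u i x := fun i =>
    hηa.mul (hu.stressField c i)
  have hVc : ∀ i, HasCompactSupport fun x => η (a • x) * stressField c u i x := fun i =>
    hηc.mul_right
  have hVi : ∀ i, Integrable (pd i fun x => η (a • x) * stressField c u i x) := fun i =>
    ((hV i).pd i).continuous.integrable_of_hasCompactSupport ((hVc i).pd i)
  have hzero : ∫ x, ∑ i, pd i (fun x => η (a • x) * stressField c u i x) x = 0 := by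
    rw [integral_finsetSum _ fun i _ => hVi i]
    exact Finset.sum_eq_zero fun i _ => integral_pd_eq_zero (hV i) (hVc i) i
  have hpt : ∀ x, ∑ i, pd i (fun x => η (a • x) * stressField c u i x) x =
      ∑ i, (K i i (a • x) * energyDensity c u x
        - ∑ j, K i j (a • x) * inner ℝ (pd i u x) (pd j u x))
      + η (a • x) * (m * energyDensity c u x - gradSq u x) := by
    intro x
    rw [← sum_pd_stressField hu heq x, Finset.mul_sum, ← Finset.sum_add_distrib]
    refine Finset.sum_congr rfl fun i _ => ?_
    rw [pd_mul hηa (hu.stressField c i), pd_comp_smul]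
    simp only [stressField, radialDeriv, inner_sum, inner_smul_right, K, mul_sub, Finset.mul_sum,
      smul_eq_mul, PiLp.smul_apply]
    congr 2
    · ring
    · exact Finset.sum_congr rfl fun j _ => by ring
  simp_rw [hpt] at hzero
  have i1 : ∀ i, Integrable fun x => K i i (a • x) * energyDensity c u x := fun i => (t1 i).1 k
  have i2 : ∀ i j, Integrable fun x => K i j (a • x) * inner ℝ (pd i u x) (pd j u x) :=
    fun i j => (t2 i j).1 k
  have i3 : ∀ i, Integrable fun x => ∑ j, K i j (a • x) * inner ℝ (pd i u x) (pd j u x) :=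
    fun i => integrable_finsetSum _ fun j _ => i2 i j
  have i4 : ∀ i, Integrable fun x => K i i (a • x) * energyDensity c u x
        - ∑ j, K i j (a • x) * inner ℝ (pd i u x) (pd j u x) := fun i => (i1 i).sub (i3 i)
  rw [integral_add (integrable_finsetSum _ fun i _ => i4 i) (t3.1 k),
    integral_finsetSum _ fun i _ => i4 i] at hzero
  rw [← hzero]
  congr 1
  refine Finset.sum_congr rfl fun i _ => ?_
  rw [integral_sub (i1 i) (i3 i), integral_finsetSum _ fun j _ => i2 i j]

theorem integrable_energyDensity (hu : ContDiff ℝ ∞ u) (hc : 0 < c) (hle : ∀ x, ‖u x‖ ≤ 1)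
    (hi : Integrable fun x => gradSq u x / 2 + c / 4 * (1 - ‖u x‖ ^ 2)) :
    Integrable (energyDensity c u) := by
  refine hi.mono' (hu.energyDensity c).continuous.aestronglyMeasurable
    (Eventually.of_forall fun x => ?_)
  have h0 : 0 ≤ 1 - ‖u x‖ ^ 2 := by nlinarith [hle x, norm_nonneg (u x)]
  have h1 : (1 - ‖u x‖ ^ 2) * (1 - ‖u x‖ ^ 2) ≤ 1 - ‖u x‖ ^ 2 :=
    mul_le_of_le_one_left h0 (by linarith [sq_nonneg ‖u x‖])
  have h2 := gradSq_nonneg u x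
  have h3 := mul_le_mul_of_nonneg_left h1 (show 0 ≤ c / 4 by positivity)
  have h4 : 0 ≤ energyDensity c u x := by unfold energyDensity; positivity
  rw [Real.norm_of_nonneg h4, energyDensity]
  linarith

theorem integrable_gradSq (hu : ContDiff ℝ ∞ u) (hc : 0 < c) (hle : ∀ x, ‖u x‖ ≤ 1)
    (hi : Integrable fun x => gradSq u x / 2 + c / 4 * (1 - ‖u x‖ ^ 2)) :
    Integrable (gradSq u) := by
  refine (hi.const_mul 2).mono' hu.gradSq.continuous.aestronglyMeasurable
    (Eventually.of_forall fun x => ?_)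
  have h0 : 0 ≤ 1 - ‖u x‖ ^ 2 := by nlinarith [hle x, norm_nonneg (u x)]
  have := mul_nonneg hc.le h0
  rw [Real.norm_of_nonneg (gradSq_nonneg u x)]
  linarith

theorem norm_eq_one_of_two_le (hm : 2 ≤ m) (hu : ContDiff ℝ ∞ u) (hc : 0 < c)
    (heq : ∀ x, ∑ i, pd i (pd i u) x = -(c * (1 - ‖u x‖ ^ 2)) • u x) {P : H} (hP : ‖P‖ = 1)
    (hlim : Tendsto u (Bornology.cobounded (EuclideanSpace ℝ (Fin m))) (𝓝 P))
    (x : EuclideanSpace ℝ (Fin m)) : ‖u x‖ = 1 := by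
  have hle := norm_le_one_of_tendsto hu hc heq hP hlim
  have hi := integrable_gradSq_add hu hc heq hP hlim
  have hA := integrable_gradSq hu hc hle hi
  have he := integrable_energyDensity hu hc hle hi
  have hm' : (2 : ℝ) ≤ m := by exact_mod_cast hm
  have hpt : ∀ x, m * c / 4 * (1 - ‖u x‖ ^ 2) ^ 2 ≤ m * energyDensity c u x - gradSq u x := by
    intro x
    have := mul_nonneg (sub_nonneg.2 hm') (gradSq_nonneg u x)
    rw [energyDensity]
    linarith
  have hint := (integral_eq_zero_iff_of_nonneg
    (fun x => le_trans (by positivity) (hpt x)) ((he.const_mul _).sub hA)).1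
    (integral_pohozaev hu heq hA he)
  have hcont : Continuous fun x => m * energyDensity c u x - gradSq u x :=
    (continuous_const.mul (hu.energyDensity c).continuous).sub hu.gradSq.continuous
  have hz := congrFun ((hcont.ae_eq_iff_eq volume continuous_zero).1 hint) x
  have h1 : m * c / 4 * (1 - ‖u x‖ ^ 2) ^ 2 ≤ 0 := (hpt x).trans hz.le
  have h2 : (1 - ‖u x‖ ^ 2) ^ 2 = 0 :=
    le_antisymm (nonpos_of_mul_nonpos_right h1 (by positivity)) (sq_nonneg _)
  have h3 : 1 - ‖u x‖ ^ 2 = 0 := pow_eq_zero_iff (two_ne_zero) |>.1 h2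
  nlinarith [norm_nonneg (u x)]

end Pohozaev

section DimensionOne

variable {H : Type*} [NormedAddCommGroup H] [InnerProductSpace ℝ H]
  {u : EuclideanSpace ℝ (Fin 1) → H} {c : ℝ}

theorem norm_add_smul_le {a b : H} (ha : ‖a‖ ≤ 1) (hb : ‖b‖ ≤ 1) :
    ‖(1 - ‖a‖ ^ 2) • a + (1 - ‖b‖ ^ 2) • b‖ ≤ 3 * ‖a + b‖ := by
  have h : (1 - ‖a‖ ^ 2) • a + (1 - ‖b‖ ^ 2) • b =
      (1 - ‖a‖ ^ 2) • (a + b) + (‖a‖ ^ 2 - ‖b‖ ^ 2) • b := by module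
  have h1 : |‖a‖ - ‖b‖| ≤ ‖a + b‖ := by simpa using abs_norm_sub_norm_le a (-b)
  have h2 : |1 - ‖a‖ ^ 2| ≤ 1 := by
    rw [abs_le]
    constructor <;> nlinarith [norm_nonneg a]
  have h3 : |‖a‖ ^ 2 - ‖b‖ ^ 2| ≤ 2 * ‖a + b‖ := by
    rw [sq_sub_sq, abs_mul, abs_of_nonneg (by positivity)]
    exact mul_le_mul (by linarith) h1 (abs_nonneg _) (by norm_num)
  rw [h]
  refine (norm_add_le _ _).trans ?_
  rw [norm_smul, norm_smul, Real.norm_eq_abs, Real.norm_eq_abs]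
  have h4 := mul_le_mul_of_nonneg_right h2 (norm_nonneg (a + b))
  have h5 : |‖a‖ ^ 2 - ‖b‖ ^ 2| * ‖b‖ ≤ 2 * ‖a + b‖ * 1 :=
    mul_le_mul h3 hb (norm_nonneg _) (by positivity)
  linarith

/-- A solution on the line is odd about each of its zeros. -/
theorem add_reflection_eq_zero (hu : ContDiff ℝ ∞ u) (hc : 0 < c)
    (heq : ∀ x, pd 0 (pd 0 u) x = -(c * (1 - ‖u x‖ ^ 2)) • u x) (hle : ∀ x, ‖u x‖ ≤ 1)
    {x : EuclideanSpace ℝ (Fin 1)} (hx : u x = 0) {t : ℝ} (ht : 0 ≤ t) :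
    u (x + t • EuclideanSpace.single 0 (1 : ℝ)) +
      u (x + (-t) • EuclideanSpace.single 0 (1 : ℝ)) = 0 := by
  set e : EuclideanSpace ℝ (Fin 1) := EuclideanSpace.single 0 (1 : ℝ) with he
  have hline : ∀ {f : EuclideanSpace ℝ (Fin 1) → H}, ContDiff ℝ ∞ f → ∀ s : ℝ,
      HasDerivAt (fun s : ℝ => f (x + (-s) • e)) (-pd 0 f (x + (-s) • e)) s := by
    intro f hf s
    have h := (hasDerivAt_line hf x 0 (-s)).scomp s (hasDerivAt_neg s)
    rwa [neg_one_smul] at h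
  let d : ℝ → H := fun s => u (x + s • e) + u (x + (-s) • e)
  let d' : ℝ → H := fun s => pd 0 u (x + s • e) - pd 0 u (x + (-s) • e)
  let d'' : ℝ → H := fun s => pd 0 (pd 0 u) (x + s • e) + pd 0 (pd 0 u) (x + (-s) • e)
  have hd : ∀ s, HasDerivAt d (d' s) s := fun s => by
    have h := (hasDerivAt_line hu x 0 s).add (hline hu s)
    rwa [← sub_eq_add_neg] at h
  have hd' : ∀ s, HasDerivAt d' (d'' s) s := fun s => by
    have h := (hasDerivAt_line (hu.pd 0) x 0 s).sub (hline (hu.pd 0) s)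
    rwa [sub_neg_eq_add] at h
  have hY : ∀ s, HasDerivAt (fun s => (d s, d' s)) (d' s, d'' s) s := fun s =>
    (hd s).prodMk (hd' s)
  have hb : ∀ s, ‖d'' s‖ ≤ 3 * c * ‖d s‖ := by
    intro s
    have h1 : d'' s = -c • ((1 - ‖u (x + s • e)‖ ^ 2) • u (x + s • e)
        + (1 - ‖u (x + (-s) • e)‖ ^ 2) • u (x + (-s) • e)) := by
      simp only [d'', heq]
      module
    rw [h1, norm_smul, norm_neg, Real.norm_of_nonneg hc.le]
    have := mul_le_mul_of_nonneg_left
      (norm_add_smul_le (hle (x + s • e)) (hle (x + (-s) • e))) hc.le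
    simp only [d]
    linarith
  have hz := eq_zero_of_abs_deriv_le_mul_abs_self_of_eq_zero_right
    (f := fun s => (d s, d' s)) (f' := fun s => (d' s, d'' s)) (K := 1 + 3 * c) (a := 0) (b := t)
    (fun s _ => (hY s).continuousAt.continuousWithinAt) (fun s _ => (hY s).hasDerivWithinAt)
    (by simp [d, d', hx]) (fun s _ => by
      have h1 := norm_fst_le (d s, d' s)
      have h2 := norm_snd_le (d s, d' s)
      simp only at h1 h2
      have h3 := mul_le_mul_of_nonneg_left h1 (show 0 ≤ 3 * c by positivity)
      have h4 := norm_nonneg (d s, d' s)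
      have h5 := mul_nonneg (show 0 ≤ 3 * c by positivity) h4
      refine norm_prod_le_iff.2 ⟨?_, ?_⟩
      · simp only
        linarith
      · simp only
        linarith [hb s]) t ⟨ht, le_rfl⟩
  exact congrArg Prod.fst hz

theorem ne_zero_of_dimension_one (hu : ContDiff ℝ ∞ u) (hc : 0 < c)
    (heq : ∀ x, pd 0 (pd 0 u) x = -(c * (1 - ‖u x‖ ^ 2)) • u x) (hle : ∀ x, ‖u x‖ ≤ 1)
    {P : H} (hP : ‖P‖ = 1)
    (hlim : Tendsto u (Bornology.cobounded (EuclideanSpace ℝ (Fin 1))) (𝓝 P))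
    (x : EuclideanSpace ℝ (Fin 1)) : u x ≠ 0 := by
  intro hx
  have hcob : ∀ v : EuclideanSpace ℝ (Fin 1), ‖v‖ = 1 →
      Tendsto (fun t : ℝ => x + t • v) atTop (Bornology.cobounded _) := by
    intro v hv
    rw [← tendsto_norm_atTop_iff_cobounded]
    refine tendsto_atTop_mono' _ ?_ (tendsto_atTop_add_const_right atTop (-‖x‖) tendsto_id)
    filter_upwards [eventually_ge_atTop 0] with t ht
    have h1 : ‖t • v‖ = t := by rw [norm_smul, hv, mul_one, Real.norm_of_nonneg ht]
    have h2 := norm_sub_le (x + t • v) x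
    rw [add_sub_cancel_left, h1] at h2
    simp only [id]
    linarith
  set e : EuclideanSpace ℝ (Fin 1) := EuclideanSpace.single 0 (1 : ℝ) with he
  have h1 := hlim.comp (hcob e (by simp [he]))
  have h2 := hlim.comp (hcob (-e) (by simp [he]))
  have h3 : Tendsto (fun _ : ℝ => (0 : H)) atTop (𝓝 (P + P)) := by
    refine (h1.add h2).congr' ?_
    filter_upwards [eventually_ge_atTop 0] with t ht
    simpa using add_reflection_eq_zero hu hc heq hle hx ht
  have h4 : P + P = 0 := (tendsto_nhds_unique h3 tendsto_const_nhds)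
  have h5 : P = 0 := by
    rw [← two_smul ℝ] at h4
    simpa using h4
  simp [h5] at hP

theorem norm_sq_pd_eq_of_dimension_one (hu : ContDiff ℝ ∞ u) (hc : 0 < c)
    (heq : ∀ x, pd 0 (pd 0 u) x = -(c * (1 - ‖u x‖ ^ 2)) • u x) (hle : ∀ x, ‖u x‖ ≤ 1)
    (hi : Integrable fun x => gradSq u x / 2 + c / 4 * (1 - ‖u x‖ ^ 2))
    (x : EuclideanSpace ℝ (Fin 1)) : ‖pd 0 u x‖ ^ 2 = c / 2 * (1 - ‖u x‖ ^ 2) ^ 2 := by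
  have hE : ContDiff ℝ ∞ fun x => gradSq u x - energyDensity c u x :=
    hu.gradSq.sub (hu.energyDensity c)
  have hg : gradSq u = fun x => ‖pd 0 u x‖ ^ 2 := by
    ext x
    simp [gradSq]
  have hconst := eq_of_pd_eq_zero hE fun i y => by
    rw [Subsingleton.elim i 0, pd_sub hu.gradSq (hu.energyDensity c), pd_energyDensity hu, hg,
      pd_norm_sq (hu.pd 0)]
    simp only [Finset.univ_unique, Fin.default_eq_zero, Finset.sum_singleton, heq,
      inner_smul_right, real_inner_comm (u y) (pd 0 u y)]
    ring
  have hint : Integrable fun x => gradSq u x - energyDensity c u x :=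
    (integrable_gradSq hu hc hle hi).sub (integrable_energyDensity hu hc hle hi)
  have hint' : Integrable fun _ : EuclideanSpace ℝ (Fin 1) =>
      gradSq u x - energyDensity c u x := hint.congr (Eventually.of_forall fun y => hconst y x)
  have h0 : gradSq u x - energyDensity c u x = 0 := by
    rcases integrable_const_iff.1 hint' with h | h
    · exact h
    · exact absurd (isFiniteMeasure_iff _ |>.1 h) (by simp)
  rw [energyDensity, hg] at h0
  linarith

theorem norm_eq_one_of_dimension_one (hu : ContDiff ℝ ∞ u) (hc : 0 < c)
    (heq' : ∀ x, ∑ i, pd i (pd i u) x = -(c * (1 - ‖u x‖ ^ 2)) • u x) {P : H} (hP : ‖P‖ = 1)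
    (hlim : Tendsto u (Bornology.cobounded (EuclideanSpace ℝ (Fin 1))) (𝓝 P))
    (x : EuclideanSpace ℝ (Fin 1)) : ‖u x‖ = 1 := by
  have hle := norm_le_one_of_tendsto hu hc heq' hP hlim
  have hi := integrable_gradSq_add hu hc heq' hP hlim
  have heq : ∀ x, pd 0 (pd 0 u) x = -(c * (1 - ‖u x‖ ^ 2)) • u x := by simpa using heq'
  have hen := norm_sq_pd_eq_of_dimension_one hu hc heq hle hi
  have hs : ContDiff ℝ ∞ fun y => 1 - ‖u y‖ ^ 2 := contDiff_const.sub (hu.norm_sq ℝ)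
  have hlims : Tendsto (fun y => 1 - ‖u y‖ ^ 2)
      (Bornology.cobounded (EuclideanSpace ℝ (Fin 1))) (𝓝 0) := by
    simpa [hP] using (hlim.norm.pow 2).const_sub 1
  have hw : Tendsto (pd 0 u) (Bornology.cobounded (EuclideanSpace ℝ (Fin 1))) (𝓝 0) := by
    rw [tendsto_zero_iff_norm_tendsto_zero]
    have h1 : Tendsto (fun y => ‖pd 0 u y‖ ^ 2)
        (Bornology.cobounded (EuclideanSpace ℝ (Fin 1))) (𝓝 0) := by
      simp_rw [hen]
      simpa using (hlims.pow 2).const_mul (c / 2)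
    simpa [Real.sqrt_sq] using h1.sqrt
  have hang : ∀ (a b : H) y, inner ℝ a (u y) * inner ℝ b (pd 0 u y)
      - inner ℝ b (u y) * inner ℝ a (pd 0 u y) = 0 := by
    intro a b y
    have hin : ∀ (a : H) {f : EuclideanSpace ℝ (Fin 1) → H}, ContDiff ℝ ∞ f →
        ContDiff ℝ ∞ fun y => inner ℝ a (f y) := fun a _ hf => contDiff_const.inner ℝ hf
    have hpd : ∀ (a : H) {f : EuclideanSpace ℝ (Fin 1) → H}, ContDiff ℝ ∞ f → ∀ i,
        pd i (fun y => inner ℝ a (f y)) = fun y => inner ℝ a (pd i f y) := by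
      intro a f hf i
      rw [pd_inner contDiff_const hf, pd_const]
      simp
    have hu' := hu.pd 0
    have hconst := eq_of_pd_eq_zero (((hin a hu).mul (hin b hu')).sub ((hin b hu).mul (hin a hu')))
      fun i z => by
        rw [Subsingleton.elim i 0, pd_sub ((hin a hu).mul (hin b hu')) ((hin b hu).mul (hin a hu')),
          pd_mul (hin a hu) (hin b hu'), pd_mul (hin b hu) (hin a hu'), hpd a hu, hpd b hu,
          hpd a hu', hpd b hu']
        simp only [heq, inner_smul_right]
        ring
    have hl : Tendsto (fun y => inner ℝ a (u y) * inner ℝ b (pd 0 u y)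
        - inner ℝ b (u y) * inner ℝ a (pd 0 u y))
        (Bornology.cobounded (EuclideanSpace ℝ (Fin 1))) (𝓝 0) := by
      simpa using (((tendsto_const_nhds (x := a)).inner (𝕜 := ℝ) hlim).mul
        ((tendsto_const_nhds (x := b)).inner (𝕜 := ℝ) hw)).sub
        (((tendsto_const_nhds (x := b)).inner (𝕜 := ℝ) hlim).mul
        ((tendsto_const_nhds (x := a)).inner (𝕜 := ℝ) hw))
    exact tendsto_nhds_unique (tendsto_const_nhds.congr fun z => hconst y z) hl
  by_contra hx
  have hpos : 0 < 1 - ‖u x‖ ^ 2 := by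
    have h1 : ‖u x‖ < 1 := lt_of_le_of_ne (hle x) hx
    nlinarith [norm_nonneg (u x)]
  rw [Metric.cobounded_eq_cocompact] at hlims
  obtain ⟨y, hy⟩ := hs.continuous.exists_forall_ge' x (hlims.eventually_le_const hpos)
  have hmax : IsLocalMax (fun y => 1 - ‖u y‖ ^ 2) y := Eventually.of_forall hy
  have hypos : 0 < 1 - ‖u y‖ ^ 2 := hpos.trans_le (hy x)
  have horth : inner ℝ (u y) (pd 0 u y) = 0 := by
    have := hmax.pd_eq_zero 0
    rw [pd_one_sub_norm_sq hu] at this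
    linarith
  have hprod := hang (u y) (pd 0 u y) y
  rw [horth, real_inner_self_eq_norm_sq, real_inner_self_eq_norm_sq, hen] at hprod
  have hu0 : 0 < ‖u y‖ := norm_pos_iff.2 (ne_zero_of_dimension_one hu hc heq hle hP hlim y)
  have : 0 < ‖u y‖ ^ 2 * (c / 2 * (1 - ‖u y‖ ^ 2) ^ 2) := by positivity
  linarith

end DimensionOne

theorem mainTheorem11 (m n : ℕ) (hm : 1 ≤ m) (ε : ℝ) (hε : 0 < ε)
    (u : EuclideanSpace ℝ (Fin m) → EuclideanSpace ℝ (Fin n))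
    (hu : IsGinzburgLandauCritical ε u)
    (P₀ : EuclideanSpace ℝ (Fin n)) (hP₀ : P₀ ∈ Metric.sphere (0 : EuclideanSpace ℝ (Fin n)) 1)
    (hlim : Filter.Tendsto u (Bornology.cobounded (EuclideanSpace ℝ (Fin m))) (𝓝 P₀)) :
    ∃ c ∈ Metric.sphere (0 : EuclideanSpace ℝ (Fin n)) 1, ∀ x, u x = c := by
  have hc : 0 < 1 / ε ^ n := by positivity
  have hP : ‖P₀‖ = 1 := by simpa using hP₀
  have heq : ∀ x, ∑ i, pd i (pd i u) x = -((1 / ε ^ n) * (1 - ‖u x‖ ^ 2)) • u x := by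
    intro x
    rw [← laplacian_eq_sum_pd hu.smooth, neg_smul]
    exact eq_neg_of_add_eq_zero_left (hu.eulerLagrange x)
  have hle := norm_le_one_of_tendsto hu.smooth hc heq hP hlim
  have hone : ∀ x, ‖u x‖ = 1 := by
    rcases hm.eq_or_lt with rfl | hm
    · exact norm_eq_one_of_dimension_one hu.smooth hc heq hP hlim
    · exact norm_eq_one_of_two_le hm hu.smooth hc heq hP hlim
  have hconst := eq_of_pd_eq_zero hu.smooth fun i x =>
    pd_eq_zero_of_gradSq (gradSq_eq_zero_of_norm_eq_one hu.smooth heq hle (hone x)) i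
  exact ⟨u 0, by simpa using hone 0, fun x => hconst x 0⟩
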